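/- Let $p$ be a prime and let $\mathcal O$ be a $p$-adic DVR, i.e. the ring of integers (the integral closure of $\mathbb Z_p$) of a finite extension of $\mathbb Q_p$. Let $\mathfrak m$ be its maximal ideal, $\mathbb F=\mathcal O/\mathfrak m$ its residue field, and suppose that the ramification index $e$ of $\mathfrak m$ over $p$ satisfies $e\le p-1$. Let $M$ and $N$ be $\mathcal O[T]$-modules that are finite and free of the same rank $d$ as $\mathcal O$-modules. For an $\mathbb F[T]$-module $V$ of finite length, let $V^{\mathrm{ss}}$ denote its semisimplification, i.e. the direct sum of the successive quotients of a composition series of $V$. Then $$(M\otimes_{\mathcal O}\mathbb F)^{\mathrm{ss}}\cong (N\otimes_{\mathcal O}\mathbb F)^{\mathrm{ss}}\quad\text{as }\mathbb F[T]\text{-modules}$$ if and only if for all integers $n$ with $1\le n\le d$ we have $$\operatorname{tr}(T^n\mid M)\equiv \operatorname{tr}(T^n\mid N)\pmod{n\mathfrak m}.$$ In particular, if $M$ and $N$ are $\mathbb Z_p[T]$-modules that are finite and free of the same rank $d$ over $\mathbb Z_p$, then $(M\otimes\mathbb F_p)^{\mathrm{ss}}\cong(N\otimes\mathbb F_p)^{\mathrm{ss}}$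 as $\mathbb F_p[T]$-modules if and only if $\operatorname{tr}(T^n\mid M)\equiv\operatorname{tr}(T^n\mid N)\pmod{p^{1+v_p(n)}}$ for all $1\le n\le d$, where $v_p$ is the $p$-adic valuation with $v_p(p)=1$. -/

import Mathlib

open scoped Polynomial TensorProduct DirectSum

universe u v w

noncomputable section

/-! ### Rings of integers of finite extensions of `ℚ_[p]` -/

/-- The ring of integers of a `p`-adic field `K` (a finite extension of `ℚ_[p]`): the integral
closure of `ℤ_[p]` in `K`. -/
abbrev PadicDVR (p : ℕ) [Fact p.Prime] (K : Type u) [Field K] [Algebra ℤ_[p] K] : Type u :=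
  integralClosure ℤ_[p] K

namespace PadicDVR

variable {p : ℕ} [Fact p.Prime] {K : Type u} [Field K] [Algebra ℚ_[p] K]
  [Algebra ℤ_[p] K] [IsScalarTower ℤ_[p] ℚ_[p] K]

/-- An element is integral over `ℤ_[p]` iff its spectral norm is at most one. -/
theorem isIntegral_iff_spectralNorm_le_one [FiniteDimensional ℚ_[p] K] (x : K) :
    IsIntegral ℤ_[p] x ↔ spectralNorm ℚ_[p] K x ≤ 1 := by
  have hx : IsIntegral ℚ_[p] x := Algebra.IsIntegral.isIntegral x
  rw [spectralNorm, spectralValue_le_one_iff (minpoly.monic hx)]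
  constructor
  · intro h n
    rw [minpoly.isIntegrallyClosed_eq_field_fractions' ℚ_[p] h, Polynomial.coeff_map]
    exact PadicInt.norm_le_one _
  · intro h
    have hl : minpoly ℚ_[p] x ∈ Polynomial.lifts (algebraMap ℤ_[p] ℚ_[p]) := by
      rw [Polynomial.lifts_iff_coeff_lifts]
      intro n
      exact ⟨⟨_, h n⟩, rfl⟩
    obtain ⟨q, hq, -, hm⟩ := Polynomial.lifts_and_degree_eq_and_monic hl (minpoly.monic hx)
    refine ⟨q, hm, ?_⟩
    have h0 : Polynomial.aeval x (q.map (algebraMap ℤ_[p] ℚ_[p])) = 0 := by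
      rw [hq]; exact minpoly.aeval _ _
    rwa [Polynomial.aeval_map_algebraMap] at h0

/-- The ring of integers of a `p`-adic field is local. -/
instance isLocalRing [FiniteDimensional ℚ_[p] K] : IsLocalRing (PadicDVR p K) := by
  have hmul : ∀ x y : K, spectralNorm ℚ_[p] K (x * y) =
      spectralNorm ℚ_[p] K x * spectralNorm ℚ_[p] K y :=
    fun x y => map_mul (spectralMulAlgNorm ℚ_[p] K) x y
  have h1 : spectralNorm ℚ_[p] K 1 = 1 := map_one (spectralMulAlgNorm ℚ_[p] K)
  have key : ∀ a : PadicDVR p K, IsUnit a ↔ spectralNorm ℚ_[p] K (a : K) = 1 := by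
    intro a
    have ha := (isIntegral_iff_spectralNorm_le_one (p := p) (a : K)).1 a.2
    constructor
    · rintro ⟨b, rfl⟩
      have hb := (isIntegral_iff_spectralNorm_le_one (p := p) _).1 (↑b⁻¹ : PadicDVR p K).2
      have hab : ((b : PadicDVR p K) : K) * ((↑b⁻¹ : PadicDVR p K) : K) = 1 := by
        exact_mod_cast congrArg Subtype.val b.mul_inv
      have := hmul ((b : PadicDVR p K) : K) ((↑b⁻¹ : PadicDVR p K) : K)
      rw [hab, h1] at this
      nlinarith [spectralNorm_nonneg (K := ℚ_[p]) (((b : PadicDVR p K)) : K)]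
    · intro h
      have h0 : (a : K) ≠ 0 := by
        intro h0
        rw [h0, spectralNorm_zero] at h
        exact zero_ne_one h
      have hinv : spectralNorm ℚ_[p] K (a : K)⁻¹ ≤ 1 := by
        have := hmul (a : K) (a : K)⁻¹
        rw [mul_inv_cancel₀ h0, h1, h, one_mul] at this
        exact this.symm.le
      refine IsUnit.of_mul_eq_one ⟨(a : K)⁻¹, (isIntegral_iff_spectralNorm_le_one _).2 hinv⟩ ?_
      exact Subtype.ext (mul_inv_cancel₀ h0)
  refine IsLocalRing.of_nonunits_add fun a b ha hb => ?_
  rw [mem_nonunits_iff, key] at ha hb ⊢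
  have ha' := lt_of_le_of_ne ((isIntegral_iff_spectralNorm_le_one (p := p) (a : K)).1 a.2) ha
  have hb' := lt_of_le_of_ne ((isIntegral_iff_spectralNorm_le_one (p := p) (b : K)).1 b.2) hb
  exact ne_of_lt (lt_of_le_of_lt (isNonarchimedean_spectralNorm (K := ℚ_[p]) (a : K) (b : K))
    (max_lt ha' hb'))

end PadicDVR

/-! ### Semisimplification -/

section Semisimplification

variable {R : Type u} [Ring R] {V : Type v} [AddCommGroup V] [Module R V]

/-- The direct sum `⨁ i, V_{i+1} / V_i` of the successive quotients of a composition series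
`V_0 < V_1 < ⋯ < V_k` of submodules. -/
abbrev CompositionSeries.Graded (s : CompositionSeries (Submodule R V)) : Type v :=
  ⨁ i : Fin s.length, (↥(s i.succ) ⧸ (s i.castSucc).submoduleOf (s i.succ))

/-- Jordan–Hölder: up to isomorphism, the direct sum of the successive quotients does not depend on
the composition series. -/
theorem CompositionSeries.graded_equiv (s t : CompositionSeries (Submodule R V))
    (hb : s.head = t.head) (ht : s.last = t.last) : Nonempty (s.Graded ≃ₗ[R] t.Graded) := by
  classical
  obtain ⟨e, he⟩ := CompositionSeries.jordan_holder s t hb ht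
  refine ⟨(DFinsupp.mapRange.linearEquiv fun i => (he i).linearEquiv) ≪≫ₗ
    (DirectSum.lequivCongrLeft R (M := fun i : Fin s.length =>
      (↥(t (e i).succ) ⧸ (t (e i).castSucc).submoduleOf (t (e i).succ))) e) ≪≫ₗ
    DFinsupp.mapRange.linearEquiv fun k => ?_⟩
  exact LinearEquiv.cast (R := R) (M := fun i : Fin t.length =>
    (↥(t i.succ) ⧸ (t i.castSucc).submoduleOf (t i.succ))) (e.apply_symm_apply k)

variable (R V)

/-- The semisimplification `V^ss` of a module of finite length: the direct sum of the successive
quotients of a composition series `0 = V_0 < V_1 < ⋯ < V_k = V` (some fixed choice; the result is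
independent of it up to isomorphism). -/
abbrev Semisimplification [IsNoetherian R V] [IsArtinian R V] : Type v :=
  (exists_compositionSeries_of_isNoetherian_isArtinian R V).choose.Graded

end Semisimplification

/-! ### Modules over `R[T]` and their reductions -/

section Operator

/-- The `R`-linear operator `T` on an `R[T]`-module `M`. -/
abbrev opT (R : Type u) [CommRing R] (M : Type v) [AddCommGroup M] [Module R M] [Module R[X] M]
    [IsScalarTower R R[X] M] : Module.End R M :=
  Algebra.lsmul R R M (Polynomial.X : R[X])

/-- For an `O[T]`-module `M` over a local ring `O` with residue field `F`, the `F[T]`-module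
`F ⊗[O] M` on which `T` acts as `1 ⊗ T`. -/
abbrev ReductionModule (O : Type u) [CommRing O] [IsLocalRing O] (M : Type v) [AddCommGroup M]
    [Module O M] [Module O[X] M] [IsScalarTower O O[X] M] : Type (max u v) :=
  Module.AEval' ((opT O M).baseChange (IsLocalRing.ResidueField O))

variable {F : Type u} [Field F] {V : Type v} [AddCommGroup V] [Module F V] [Module.Finite F V]
  (φ : Module.End F V)

instance AEvalPrime.moduleFinite : Module.Finite F (Module.AEval' φ) :=
  Module.Finite.equiv (Module.AEval'.of φ)

instance AEvalPrime.isNoetherian : IsNoetherian F[X] (Module.AEval' φ) := isNoetherian_of_tower F inferInstance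

instance AEvalPrime.isArtinian : IsArtinian F[X] (Module.AEval' φ) := isArtinian_of_tower F inferInstance

end Operator

end

/-!
Both sides of the criterion are conditions on the characteristic polynomials `P`, `Q` of `T` on
`M` and `N`: each says that `P ≡ Q` modulo the maximal ideal `m`.

*Semisimplifications.* A simple `F[T]`-module that is finite-dimensional over the field `F` is
`F[T] / (f)` with `f` irreducible, and `f` is the characteristic polynomial of `T` on it
(`irreducible_charpolyOfModule_and_equiv`). Since characteristic polynomials are multiplicative in
short exact sequences, the composition factors of `V` correspond to the irreducible factors of the
characteristic polynomial of `T` on `V`, and unique factorization in `F[T]` shows that `V^ss` and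
this polynomial determine each other (`nonempty_semisimplification_equiv_iff`).

*Traces.* By Jacobi's formula, `∑ tr (T ^ n) X ^ n` (over `n ≥ 1`) is `-X f' / f` for
`f = det (1 - X T)`, the reverse of the characteristic polynomial
(`Matrix.isNegLogDeriv_charpolyRev`). If `f` and `g` come from `M` and `N`, the differences
`cₙ` of the traces are therefore the coefficients of the logarithmic derivative of `h = f / g`.
Write `h = ∏ (1 - aᵢ Xⁱ)`; then `cₙ = ∑_{i ∣ n} i aᵢ ^ (n / i)`, as for the ghost components of a
Witt vector. Now `h ≡ 1` modulo `m` up to degree `d` iff `aᵢ ∈ m` for `i ≤ d`, and this holds iff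
`cₙ ∈ n m` for `n ≤ d` (`PowerSeries.sub_one_mem_lowCoeffIdeal_iff`). Both implications of the
latter rest on `a ^ k ∈ k m` for `a ∈ m`, which is where `e ≤ p - 1` enters: if `p ^ j` is the exact
power of `p` dividing `k`, then `k ≥ p ^ j ≥ 1 + j (p - 1) ≥ 1 + j e`
(`Ideal.pow_mem_span_natCast_mul`). Using the `aᵢ` in place of a logarithm and an exponential keeps
all computations inside the ring of integers. Since `f` and `g` have degree at most `d`, only the
coefficients up to `X ^ d` matter.
-/

/-! ### Powers of elements of an ideal -/

/-- If `(p)` contains `m ^ e` with `e ≤ p - 1`, then `x ^ k` is divisible by `k m` for `x ∈ m`: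
the power of `x` outweighs the powers of `p` in `k`. -/
theorem Ideal.pow_mem_span_natCast_mul {R : Type*} [CommRing R] {p e : ℕ} (hp : p.Prime)
    {m : Ideal R} (hunit : ∀ k : ℕ, p.Coprime k → IsUnit (k : R))
    (hme : m ^ e ≤ Ideal.span {(p : R)}) (he : e ≤ p - 1) {x : R} (hx : x ∈ m) {k : ℕ}
    (hk : k ≠ 0) : x ^ k ∈ Ideal.span {(k : R)} * m := by
  obtain ⟨j, k', hk', rfl⟩ := Nat.exists_eq_pow_mul_and_not_dvd hk p hp.ne_one
  have hu : IsUnit (k' : R) := hunit k' ((Nat.Prime.coprime_iff_not_dvd hp).2 hk')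
  have hk0 : 0 < k' := Nat.pos_of_ne_zero (by rintro rfl; simp at hk')
  have hspan : Ideal.span {((p ^ j * k' : ℕ) : R)} = Ideal.span {(p : R)} ^ j := by
    rw [Ideal.span_singleton_pow, Nat.cast_mul, Nat.cast_pow, Ideal.span_singleton_mul_right_unit hu]
  rw [hspan]
  -- Bernoulli's inequality: `p ^ j ≥ 1 + j * (p - 1) ≥ 1 + e * j`.
  have hle : e * j + 1 ≤ p ^ j * k' := by
    have h1 : j * (p - 1) + 1 ≤ p ^ j := by
      have := one_add_mul_le_pow (R := ℤ) (a := (p : ℤ) - 1) (by have := hp.two_le; omega) j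
      have h2 : ((p - 1 : ℕ) : ℤ) = (p : ℤ) - 1 := by have := hp.two_le; omega
      zify
      rw [h2]
      simpa [add_comm] using this
    calc e * j + 1 ≤ j * (p - 1) + 1 := by rw [mul_comm]; gcongr
      _ ≤ p ^ j := h1
      _ ≤ p ^ j * k' := Nat.le_mul_of_pos_right _ hk0
  have h1 : x ^ (p ^ j * k') ∈ m ^ (e * j + 1) := Ideal.pow_le_pow_right hle (Ideal.pow_mem_pow hx _)
  rw [pow_succ, pow_mul] at h1
  exact Ideal.mul_mono_left (Ideal.pow_right_mono hme j) h1

/-! ### Logarithmic derivatives of power series and ghost components -/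

namespace PowerSeries

variable {R : Type*} [CommRing R]

/-- `IsNegLogDeriv f s` says that `s` is `-X f' / f`, the generating series of the power sums
of the `αᵢ` if `f = ∏ (1 - αᵢ X)`; the division is cleared. -/
def IsNegLogDeriv (f s : R⟦X⟧) : Prop := X * d⁄dX R f = -(f * s)

theorem IsNegLogDeriv.mul {f g s t : R⟦X⟧} (hf : IsNegLogDeriv f s) (hg : IsNegLogDeriv g t) :
    IsNegLogDeriv (f * g) (s + t) := by
  unfold IsNegLogDeriv at *
  rw [Derivation.leibniz, smul_eq_mul, smul_eq_mul]
  linear_combination f * hg + g * hf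

theorem IsNegLogDeriv.prod {ι : Type*} (I : Finset ι) {f s : ι → R⟦X⟧}
    (h : ∀ i ∈ I, IsNegLogDeriv (f i) (s i)) : IsNegLogDeriv (∏ i ∈ I, f i) (∑ i ∈ I, s i) := by
  classical
  induction I using Finset.induction_on with
  | empty => simp [IsNegLogDeriv]
  | insert a I ha ih =>
    rw [Finset.prod_insert ha, Finset.sum_insert ha]
    exact (h a (by simp)).mul (ih fun i hi => h i (by simp [hi]))

/-- Cancellation for logarithmic derivatives: they send quotients to differences. -/
theorem IsNegLogDeriv.of_mul {f g s t : R⟦X⟧} (hf : IsUnit f) (hfs : IsNegLogDeriv f s)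
    (h : IsNegLogDeriv (f * g) t) : IsNegLogDeriv g (t - s) := by
  unfold IsNegLogDeriv at *
  rw [Derivation.leibniz, smul_eq_mul, smul_eq_mul] at h
  apply hf.mul_left_cancel
  linear_combination h - g * hfs

/-- The logarithmic derivative `-X f' / f` up to a given degree depends only on `f` up to that
degree: the factor `X` makes up for the degree lost in `f'`. -/
theorem IsNegLogDeriv.X_pow_dvd_sub {f g s t : R⟦X⟧} (hf : IsUnit f) (hfs : IsNegLogDeriv f s)
    (hgt : IsNegLogDeriv g t) {n : ℕ} (h : X ^ n ∣ f - g) : X ^ n ∣ s - t := by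
  have hd : X ^ n ∣ X * d⁄dX R (f - g) := by
    obtain ⟨q, hq⟩ := h
    rw [hq, Derivation.leibniz, smul_eq_mul, smul_eq_mul]
    cases n with
    | zero => simp
    | succ n =>
      rw [derivative_pow, derivative_X]
      refine ⟨X * d⁄dX R q + q * ((n + 1 : ℕ) : R⟦X⟧), ?_⟩
      simp only [Nat.add_sub_cancel]
      ring
  rw [← hf.dvd_mul_left (a := X ^ n)]
  unfold IsNegLogDeriv at *
  have : f * (s - t) = -(X * d⁄dX R (f - g)) - (f - g) * t := by
    rw [map_sub]
    linear_combination hfs - hgt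
  rw [this]
  exact (hd.neg_right).sub (h.mul_right t)

/-- The series `∑_{j ≥ 1} k a ^ j X ^ (k j)`, the negative logarithmic derivative of
`1 - a X ^ k`. -/
noncomputable def ghostSeries (a : R) (k : ℕ) : R⟦X⟧ :=
  mk fun n => if k ∣ n ∧ n ≠ 0 then (k : R) * a ^ (n / k) else 0

theorem isNegLogDeriv_ghostSeries (a : R) {k : ℕ} (hk : k ≠ 0) :
    IsNegLogDeriv (1 - C a * X ^ k) (ghostSeries a k) := by
  have h1 : (1 - C a * X ^ k) * ghostSeries a k = C (k * a) * X ^ k := by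
    ext n
    rw [sub_mul, one_mul, mul_assoc, map_sub, coeff_C_mul, coeff_C_mul, coeff_X_pow_mul',
      coeff_X_pow]
    simp only [ghostSeries, coeff_mk]
    rcases lt_trichotomy n k with h | rfl | h
    · have : ¬ (k ∣ n ∧ n ≠ 0) := fun ⟨h1, h2⟩ => h2 (Nat.eq_zero_of_dvd_of_lt h1 h)
      rw [if_neg this, if_neg (by omega), if_neg (by omega)]
      simp
    · simp [hk, Nat.div_self (Nat.pos_of_ne_zero hk)]
    · rw [if_pos h.le, if_neg h.ne']
      by_cases hd : k ∣ n
      · rw [if_pos ⟨hd, by omega⟩, if_pos ⟨Nat.dvd_sub hd dvd_rfl, by omega⟩]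
        have : n / k = (n - k) / k + 1 := by
          conv_lhs => rw [← Nat.sub_add_cancel h.le]
          exact Nat.add_div_right _ (Nat.pos_of_ne_zero hk)
        rw [this]
        ring
      · have : ¬ k ∣ n - k := fun h' => hd ((Nat.dvd_sub_iff_left h.le dvd_rfl).1 h')
        rw [if_neg (by tauto), if_neg (by tauto)]
        simp
  unfold IsNegLogDeriv
  rw [h1, map_sub, derivative_one, Derivation.leibniz, derivative_C, derivative_pow, derivative_X]
  obtain ⟨k, rfl⟩ := Nat.exists_eq_succ_of_ne_zero hk
  simp only [Nat.succ_eq_add_one, Nat.add_sub_cancel, smul_eq_mul, map_mul, map_natCast]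
  ring

theorem coeff_ghostSeries_of_lt (a : R) {k n : ℕ} (h : n < k) : coeff n (ghostSeries a k) = 0 := by
  rw [ghostSeries, coeff_mk, if_neg fun ⟨h1, h2⟩ => h2 (Nat.eq_zero_of_dvd_of_lt h1 h)]

theorem coeff_ghostSeries_self (a : R) {k : ℕ} (hk : k ≠ 0) :
    coeff k (ghostSeries a k) = k * a := by
  simp [ghostSeries, hk, Nat.div_self (Nat.pos_of_ne_zero hk)]

theorem coeff_ghostSeries_mem {m : Ideal R}
    (hm : ∀ x ∈ m, ∀ k : ℕ, k ≠ 0 → x ^ k ∈ Ideal.span {(k : R)} * m) {a : R} (ha : a ∈ m)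
    (k n : ℕ) : coeff n (ghostSeries a k) ∈ Ideal.span {(n : R)} * m := by
  rw [ghostSeries, coeff_mk]
  split_ifs with h
  · obtain ⟨⟨j, rfl⟩, h0⟩ := h
    have hk : k ≠ 0 := left_ne_zero_of_mul h0
    rw [Nat.mul_div_cancel_left _ (Nat.pos_of_ne_zero hk), Nat.cast_mul,
      ← Ideal.span_singleton_mul_span_singleton, mul_assoc]
    exact Ideal.mul_mem_mul (Ideal.mem_span_singleton_self _)
      (hm a ha j (right_ne_zero_of_mul h0))
  · exact zero_mem _

/-- The ideal of power series whose coefficients of degree at most `d` lie in `m`. -/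
def lowCoeffIdeal (m : Ideal R) (d : ℕ) : Ideal R⟦X⟧ where
  carrier := {f | ∀ n ≤ d, coeff n f ∈ m}
  zero_mem' := fun n _ => by simp
  add_mem' := fun {f g} hf hg n hn => by rw [map_add]; exact add_mem (hf n hn) (hg n hn)
  smul_mem' := fun f g hg n hn => by
    rw [smul_eq_mul, coeff_mul]
    refine sum_mem fun ij hij => m.mul_mem_left _ (hg _ ?_)
    rw [Finset.HasAntidiagonal.mem_antidiagonal] at hij
    omega

theorem mem_lowCoeffIdeal {m : Ideal R} {d : ℕ} {f : R⟦X⟧} :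
    f ∈ lowCoeffIdeal m d ↔ ∀ n ≤ d, coeff n f ∈ m := Iff.rfl

theorem mem_lowCoeffIdeal_of_X_pow_dvd (m : Ideal R) {d : ℕ} {f : R⟦X⟧} (h : X ^ (d + 1) ∣ f) :
    f ∈ lowCoeffIdeal m d := fun n hn => by
  rw [X_pow_dvd_iff.1 h n (by omega)]
  exact zero_mem _

theorem prod_one_sub_sub_one_mem {m : Ideal R} {d : ℕ} {a : ℕ → R} {n : ℕ}
    (ha : ∀ i < n, a i ∈ m) :
    ∏ i ∈ Finset.range n, (1 - C (a i) * X ^ (i + 1)) - 1 ∈ lowCoeffIdeal m d := by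
  induction n with
  | zero => simp
  | succ n ih =>
    have hC : C (a n) * X ^ (n + 1) ∈ lowCoeffIdeal m d := fun j _ => by
      rw [coeff_C_mul]
      exact m.mul_mem_right _ (ha n (by omega))
    rw [Finset.prod_range_succ, mul_sub, mul_one, sub_right_comm]
    exact sub_mem (ih fun i hi => ha i (by omega)) (Ideal.mul_mem_left _ _ hC)

/-- A power series with constant term `1` agrees up to degree `n` with a product
`∏ (1 - aᵢ X ^ (i + 1))`, and the `aᵢ` inherit congruences of the series. -/
theorem exists_prod_one_sub (m : Ideal R) {f : R⟦X⟧} (hf : constantCoeff f = 1) (n : ℕ) :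
    ∃ a : ℕ → R, X ^ (n + 1) ∣ f - ∏ i ∈ Finset.range n, (1 - C (a i) * X ^ (i + 1)) ∧
      (f - 1 ∈ lowCoeffIdeal m n → ∀ i < n, a i ∈ m) := by
  induction n with
  | zero => exact ⟨0, by simp [X_dvd_iff, hf], by simp⟩
  | succ n ih =>
    obtain ⟨a, had, ham⟩ := ih
    set g := ∏ i ∈ Finset.range n, (1 - C (a i) * X ^ (i + 1)) with hg
    set c := coeff (n + 1) (g - f) with hc
    have hg' : ∏ i ∈ Finset.range n, (1 - C (Function.update a n c i) * X ^ (i + 1)) = g := by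
      refine Finset.prod_congr rfl fun i hi => ?_
      rw [Function.update_of_ne (Finset.mem_range.1 hi).ne]
    have hg0 : constantCoeff g = 1 := by simp [hg, map_prod]
    refine ⟨Function.update a n c, ?_, fun h i hi => ?_⟩
    · rw [Finset.prod_range_succ, hg', Function.update_self, X_pow_dvd_iff]
      intro j hj
      have e : f - g * (1 - C c * X ^ (n + 1)) = (f - g) + C c * (X ^ (n + 1) * g) := by ring
      rw [e, map_add, coeff_C_mul, coeff_X_pow_mul']
      rcases Nat.lt_or_ge j (n + 1) with hj' | hj'
      · rw [if_neg (by omega), X_pow_dvd_iff.1 had j hj']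
        simp
      · obtain rfl : j = n + 1 := by omega
        rw [if_pos le_rfl, Nat.sub_self, coeff_zero_eq_constantCoeff_apply, hg0, hc, map_sub,
          map_sub]
        ring
    · have ham' := ham fun j hj => h j (by omega)
      rcases Nat.lt_succ_iff_lt_or_eq.1 hi with hi' | rfl
      · rw [Function.update_of_ne hi'.ne]
        exact ham' i hi'
      · rw [Function.update_self, hc, ← sub_sub_sub_cancel_right g f 1, map_sub]
        exact sub_mem (prod_one_sub_sub_one_mem (d := i + 1) ham' _ le_rfl) (h _ le_rfl)

/-- The criterion for a single series: `f` is congruent to `1` modulo `m` up to degree `d` iff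
the coefficients `sₙ` of its logarithmic derivative are divisible by `n m`. Up to degree `d`,
`f = ∏ (1 - aᵢ Xⁱ)`, so that `sₙ = ∑_{i ∣ n} i aᵢ ^ (n / i)`. -/
theorem sub_one_mem_lowCoeffIdeal_iff [IsDomain R] [CharZero R] {m : Ideal R}
    (hm : ∀ x ∈ m, ∀ k : ℕ, k ≠ 0 → x ^ k ∈ Ideal.span {(k : R)} * m) {f s : R⟦X⟧}
    (hf : constantCoeff f = 1) (hs : IsNegLogDeriv f s) (d : ℕ) :
    f - 1 ∈ lowCoeffIdeal m d ↔ ∀ n, 1 ≤ n → n ≤ d → coeff n s ∈ Ideal.span {(n : R)} * m := by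
  obtain ⟨a, had, ham⟩ := exists_prod_one_sub m hf d
  have hfu : IsUnit f := by rw [isUnit_iff_constantCoeff, hf]; exact isUnit_one
  have hst := hs.X_pow_dvd_sub hfu (IsNegLogDeriv.prod (Finset.range d) fun i _ =>
    isNegLogDeriv_ghostSeries (a i) i.succ_ne_zero) had
  have hcoeff : ∀ n ≤ d, coeff n s = ∑ i ∈ Finset.range d, coeff n (ghostSeries (a i) (i + 1)) := by
    intro n hn
    have := X_pow_dvd_iff.1 hst n (by omega)
    rwa [map_sub, map_sum, sub_eq_zero] at this
  constructor
  · intro h n _ hn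
    rw [hcoeff n hn]
    exact sum_mem fun i hi => coeff_ghostSeries_mem hm (ham h i (Finset.mem_range.1 hi)) _ _
  · intro h
    -- In `sₙ = n aₙ + ∑_{i ∣ n, i < n} i aᵢ ^ (n / i)` the sum lies in `n m` by induction, and `n`
    -- cancels. The index of `a` is shifted: `a n` belongs to `X ^ (n + 1)`.
    have ha : ∀ i < d, a i ∈ m := by
      intro n
      induction n using Nat.strong_induction_on with
      | _ n ih =>
      intro hn
      have h1 := h (n + 1) (by omega) hn
      rw [hcoeff (n + 1) hn, ← Finset.add_sum_erase _ _ (Finset.mem_range.2 hn),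
        coeff_ghostSeries_self _ n.succ_ne_zero] at h1
      have h2 : ∑ i ∈ (Finset.range d).erase n, coeff (n + 1) (ghostSeries (a i) (i + 1)) ∈
          Ideal.span {((n + 1 : ℕ) : R)} * m := by
        refine sum_mem fun i hi => ?_
        rw [Finset.mem_erase, Finset.mem_range] at hi
        rcases lt_or_gt_of_ne hi.1 with h' | h'
        · exact coeff_ghostSeries_mem hm (ih i h' hi.2) _ _
        · rw [coeff_ghostSeries_of_lt _ (by omega)]
          exact zero_mem _
      have h3 := (Submodule.add_mem_iff_left _ h2).1 h1
      obtain ⟨z, hz, hz'⟩ := Ideal.mem_span_singleton_mul.1 h3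
      rwa [← mul_left_cancel₀ (Nat.cast_ne_zero.2 n.succ_ne_zero) hz']
    rw [← sub_add_sub_cancel f (∏ i ∈ Finset.range d, (1 - C (a i) * X ^ (i + 1))) 1]
    exact add_mem (mem_lowCoeffIdeal_of_X_pow_dvd m had) (prod_one_sub_sub_one_mem ha)

theorem sub_mem_lowCoeffIdeal_iff [IsDomain R] [CharZero R] {m : Ideal R}
    (hm : ∀ x ∈ m, ∀ k : ℕ, k ≠ 0 → x ^ k ∈ Ideal.span {(k : R)} * m) {f g s t : R⟦X⟧}
    (hf : constantCoeff f = 1) (hg : constantCoeff g = 1) (hs : IsNegLogDeriv f s)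
    (ht : IsNegLogDeriv g t) (d : ℕ) :
    f - g ∈ lowCoeffIdeal m d ↔
      ∀ n, 1 ≤ n → n ≤ d → coeff n s - coeff n t ∈ Ideal.span {(n : R)} * m := by
  have hgu : IsUnit g := by rw [isUnit_iff_constantCoeff, hg]; exact isUnit_one
  obtain ⟨q, rfl⟩ := hgu.dvd (a := f)
  rw [map_mul, hg, one_mul] at hf
  have hq := ht.of_mul hgu hs
  have e : g * q - g = g * (q - 1) := by ring
  rw [e, Ideal.unit_mul_mem_iff_mem _ hgu, sub_one_mem_lowCoeffIdeal_iff hm hf hq]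
  simp only [map_sub]

end PowerSeries

/-! ### The reverse characteristic polynomial and traces of powers -/

namespace Matrix

open Polynomial

variable {R : Type*} [CommRing R] {n : Type*} [Fintype n] [DecidableEq n]

/-- Jacobi's formula for the derivative of a determinant of polynomials. -/
theorem derivative_det (N : Matrix n n R[X]) :
    derivative N.det = (N.adjugate * N.map derivative).trace := by
  have h1 : derivative N.det = ∑ i, (N.updateCol i fun j => derivative (N j i)).det := by
    simp only [det_apply, derivative_sum]
    rw [Finset.sum_comm]
    refine Finset.sum_congr rfl fun σ _ => ?_
    rw [← Finset.smul_sum, Units.smul_def, Units.smul_def, derivative_smul,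
      derivative_prod_finset]
    congr 1
    refine Finset.sum_congr rfl fun i _ => ?_
    rw [← Finset.mul_prod_erase _ _ (Finset.mem_univ i), updateCol_self, mul_comm]
    congr 1
    refine Finset.prod_congr rfl fun j hj => ?_
    rw [updateCol_ne (Finset.ne_of_mem_erase hj)]
  rw [h1, trace]
  refine Finset.sum_congr rfl fun i _ => ?_
  rw [← cramer_apply, cramer_eq_adjugate_mulVec]
  rfl

/-- Newton's identities: `-X P' / P = ∑_{k ≥ 1} tr (M ^ k) X ^ k` for `P = det (1 - X M)`. This is
Jacobi's formula combined with `(1 - X M)⁻¹ = ∑ M ^ k X ^ k`. -/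
theorem isNegLogDeriv_charpolyRev (M : Matrix n n R) :
    PowerSeries.IsNegLogDeriv (M.charpolyRev : PowerSeries R)
      (PowerSeries.X * PowerSeries.mk fun k => (M ^ (k + 1)).trace) := by
  set N : Matrix n n R[X] := 1 - (X : R[X]) • M.map C with hN
  let φ : R[X] →+* PowerSeries R := Polynomial.coeToPowerSeries.ringHom
  let G : Matrix n n (PowerSeries R) := of fun i j => PowerSeries.mk fun k => (M ^ k) i j
  have hGa : ∀ i j, G i j = PowerSeries.mk fun k => (M ^ k) i j := fun _ _ => rfl
  have hG : N.map φ * G = 1 := by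
    have hNφ : N.map φ = 1 - (PowerSeries.X : PowerSeries R) • M.map PowerSeries.C := by
      ext1 i j
      by_cases h : i = j <;> simp [hN, φ, h, PowerSeries.X_mul]
    rw [hNφ, sub_mul, one_mul, smul_mul]
    ext i j k
    rw [sub_apply, map_sub, smul_apply, smul_eq_mul, mul_apply, Finset.mul_sum, map_sum]
    cases k with
    | zero => by_cases h : i = j <;> simp [hGa, one_apply, h]
    | succ k =>
      simp only [PowerSeries.coeff_succ_X_mul, map_apply, PowerSeries.coeff_C_mul, hGa,
        PowerSeries.coeff_mk, pow_succ', mul_apply, sub_self, one_apply]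
      split_ifs <;> simp [PowerSeries.coeff_one]
  -- Over `R⟦X⟧` the series `G` inverts `N`, so the adjugate is `det N • G`.
  have hadj : N.adjugate.map φ = φ N.det • G := by
    have h : N.adjugate.map φ * (N.map φ) * G = φ N.det • G := by
      have h1 : (N.det • (1 : Matrix n n R[X])).map φ = φ N.det • 1 := by
        ext1 i j
        by_cases h : i = j <;> simp [h]
      rw [← Matrix.map_mul, adjugate_mul, h1, smul_mul, one_mul]
    rwa [mul_assoc, hG, mul_one] at h
  have hder : N.map derivative = -M.map C := by
    ext1 i j
    simp [hN, sub_apply, one_apply, apply_ite]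
  unfold PowerSeries.IsNegLogDeriv
  have hdet : M.charpolyRev = N.det := rfl
  rw [hdet, PowerSeries.derivative_coe, derivative_det, hder]
  have htr : φ (N.adjugate * -M.map C).trace =
      -(φ N.det * PowerSeries.mk fun k => (M ^ (k + 1)).trace) := by
    have h2 : φ (N.adjugate * -M.map C).trace = ((N.adjugate.map φ) * (-M.map C).map φ).trace := by
      rw [← Matrix.map_mul, ← AddMonoidHom.map_trace]
    have h3 : (-M.map C).map φ = -M.map PowerSeries.C := by
      ext1 i j
      simp [φ]
    rw [h2, hadj, h3, mul_neg, trace_neg, smul_mul, trace_smul, smul_eq_mul]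
    congr 2
    ext k
    simp only [trace, diag_apply, map_sum, mul_apply, PowerSeries.coeff_mk, map_apply, hGa, pow_succ,
      PowerSeries.coeff_mul_C]
  have hφ : ∀ q : R[X], (q : PowerSeries R) = φ q := fun _ => rfl
  rw [hφ, hφ, htr]
  ring

end Matrix

/-! ### Characteristic polynomials of `F[T]`-modules -/

/-- The `i`-th successive quotient of a composition series. -/
abbrev CompositionSeries.Factor {R : Type u} [Ring R] {V : Type v} [AddCommGroup V] [Module R V]
    (s : CompositionSeries (Submodule R V)) (i : Fin s.length) : Type v :=
  ↥(s i.succ) ⧸ (s i.castSucc).submoduleOf (s i.succ)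

instance CompositionSeries.isSimpleModule_factor {R : Type u} [Ring R] {V : Type v}
    [AddCommGroup V] [Module R V] (s : CompositionSeries (Submodule R V)) (i : Fin s.length) :
    IsSimpleModule R (s.Factor i) :=
  (covBy_iff_quot_is_simple (s.step i).le).1 (s.step i)

section CharpolyModule

open Polynomial

open Module.Basis in
/-- Characteristic polynomials are multiplicative along an invariant submodule. -/
theorem LinearMap.charpoly_eq_charpoly_restrict_mul_charpoly_mapQ {R V : Type*} [CommRing R]
    [AddCommGroup V] [Module R V] [Module.Finite R V] [Module.Free R V] (W : Submodule R V)
    [Module.Free R W] [Module.Finite R W] [Module.Free R (V ⧸ W)] (e : V →ₗ[R] V)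
    (he : W ≤ W.comap e) :
    e.charpoly = (e.restrict he).charpoly * (W.mapQ W e he).charpoly := by
  classical
  let bW := Module.Free.chooseBasis R W
  let bQ := Module.Free.chooseBasis R (V ⧸ W)
  let b := sumQuot bW bQ
  let B : Matrix (Module.Free.ChooseBasisIndex R W) (Module.Free.ChooseBasisIndex R (V ⧸ W)) R :=
    Matrix.of fun i l ↦ (b.repr (e (b (Sum.inr l)))) (Sum.inl i)
  have key : LinearMap.toMatrix b b e = Matrix.fromBlocks (LinearMap.toMatrix bW bW (e.restrict he))
      B 0 (LinearMap.toMatrix bQ bQ (W.mapQ W e he)) := by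
    ext u v
    rcases u with i | j <;> rcases v with k | l
    · simp only [b, sumQuot_inl, Matrix.fromBlocks_apply₁₁, LinearMap.toMatrix_apply]
      apply sumQuot_repr_inl_of_mem
    · simp [b, LinearMap.toMatrix_apply, Matrix.fromBlocks_apply₁₂, B]
    · suffices W.mkQ (e (bW k)) = 0 by simp [LinearMap.toMatrix_apply, b, this]
      rw [← LinearMap.mem_ker, Submodule.ker_mkQ]
      exact he (Submodule.coe_mem (bW k))
    · simp only [LinearMap.toMatrix_apply, sumQuot_repr_inr, Matrix.fromBlocks_apply₂₂, b]
      rw [← sumQuot_inr bW bQ l, W.mapQ_apply]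
      simp
  rw [← LinearMap.charpoly_toMatrix e b, key, Matrix.charpoly_fromBlocks_zero₂₁,
    LinearMap.charpoly_toMatrix, LinearMap.charpoly_toMatrix]

variable {F : Type u} [Field F]

/-- The characteristic polynomial of `T` acting on an `F[T]`-module `V` that is
finite-dimensional over `F`. -/
noncomputable abbrev charpolyOfModule (F : Type u) [Field F] (V : Type v) [AddCommGroup V]
    [Module F V] [Module F[X] V] [IsScalarTower F F[X] V] [Module.Finite F V] : F[X] :=
  (opT F V).charpoly

section

variable {V : Type v} [AddCommGroup V] [Module F V] [Module F[X] V] [IsScalarTower F F[X] V]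
  [Module.Finite F V] {W : Type w} [AddCommGroup W] [Module F W] [Module F[X] W]
  [IsScalarTower F F[X] W] [Module.Finite F W]

theorem charpolyOfModule_congr (e : V ≃ₗ[F[X]] W) :
    charpolyOfModule F V = charpolyOfModule F W := by
  rw [charpolyOfModule, charpolyOfModule, ← LinearEquiv.charpoly_conj (e.restrictScalars F)]
  congr 1
  ext x
  simp [LinearEquiv.conj_apply]

theorem charpolyOfModule_prod :
    charpolyOfModule F (V × W) = charpolyOfModule F V * charpolyOfModule F W := by
  rw [charpolyOfModule, charpolyOfModule, charpolyOfModule, ← LinearMap.charpoly_prodMap]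
  rfl

theorem charpolyOfModule_of_subsingleton [Subsingleton V] : charpolyOfModule F V = 1 := by
  refine (LinearMap.charpoly_monic _).natDegree_eq_zero.1 ?_
  rw [LinearMap.charpoly_natDegree, Module.finrank_zero_of_subsingleton]

instance Submodule.finite_of_polynomial (P : Submodule F[X] V) : Module.Finite F P :=
  Module.Finite.of_injective (P.subtype.restrictScalars F) P.injective_subtype

instance Submodule.finite_quotient_of_polynomial (P : Submodule F[X] V) :
    Module.Finite F (V ⧸ P) :=
  Module.Finite.of_surjective (P.mkQ.restrictScalars F) P.mkQ_surjective

theorem charpolyOfModule_eq_mul (P : Submodule F[X] V) :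
    charpolyOfModule F V = charpolyOfModule F P * charpolyOfModule F (V ⧸ P) := by
  have := LinearMap.charpoly_eq_charpoly_restrict_mul_charpoly_mapQ (P.restrictScalars F)
    (opT F V) fun x hx => P.smul_mem X hx
  exact this

theorem charpolyOfModule_aeval' {V : Type v} [AddCommGroup V] [Module F V] [Module.Finite F V]
    (φ : Module.End F V) : charpolyOfModule F (Module.AEval' φ) = φ.charpoly := by
  rw [charpolyOfModule, ← LinearEquiv.charpoly_conj (Module.AEval'.of φ)]
  congr 1
  ext x
  obtain ⟨y, rfl⟩ := (Module.AEval'.of φ).surjective x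
  simp [LinearEquiv.conj_apply, Module.AEval'.X_smul_of]

end

theorem charpolyOfModule_pi {n : ℕ} (Q : Fin n → Type v) [∀ i, AddCommGroup (Q i)]
    [∀ i, Module F (Q i)] [∀ i, Module F[X] (Q i)] [∀ i, IsScalarTower F F[X] (Q i)]
    [∀ i, Module.Finite F (Q i)] :
    charpolyOfModule F (∀ i, Q i) = ∏ i, charpolyOfModule F (Q i) := by
  induction n with
  | zero => rw [charpolyOfModule_of_subsingleton]; simp
  | succ n ih =>
    rw [← charpolyOfModule_congr (Fin.consLinearEquiv F[X] Q), charpolyOfModule_prod, ih,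
      Fin.prod_univ_succ]

variable {V : Type v} [AddCommGroup V] [Module F V] [Module F[X] V] [IsScalarTower F F[X] V]
  [Module.Finite F V] {W : Type w} [AddCommGroup W] [Module F W] [Module F[X] W]
  [IsScalarTower F F[X] W] [Module.Finite F W]

/-- A simple `F[T]`-module is `F[T] / (f)` for an irreducible `f`, which is its characteristic
polynomial. -/
theorem irreducible_charpolyOfModule_and_equiv [IsSimpleModule F[X] V] :
    Irreducible (charpolyOfModule F V) ∧
      Nonempty (V ≃ₗ[F[X]] F[X] ⧸ Ideal.span {charpolyOfModule F V}) := by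
  obtain ⟨I, hI, ⟨e⟩⟩ := isSimpleModule_iff_quot_maximal.1 (inferInstance : IsSimpleModule F[X] V)
  -- By Cayley–Hamilton the annihilator `I` contains the characteristic polynomial.
  have hmem : charpolyOfModule F V ∈ I := by
    have h1 : charpolyOfModule F V • e.symm 1 = 0 := by
      have h2 := LinearMap.congr_fun (LinearMap.aeval_self_charpoly (opT F V)) (e.symm 1)
      rwa [opT, Polynomial.aeval_algHom_apply, Polynomial.aeval_X_left_apply] at h2
    rw [← map_smul, LinearEquiv.map_eq_zero_iff] at h1
    rw [← Ideal.Quotient.eq_zero_iff_mem, ← h1, ← Ideal.Quotient.mk_eq_mk,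
      ← (Ideal.Quotient.mk I).map_one, ← Ideal.Quotient.mk_eq_mk, ← Submodule.Quotient.mk_smul]
    simp
  obtain ⟨g, rfl⟩ := (IsPrincipalIdealRing.principal I).principal
  rw [Ideal.submodule_span_eq] at hmem hI e
  have hmon : (charpolyOfModule F V).Monic := LinearMap.charpoly_monic _
  have hdvd : g ∣ charpolyOfModule F V := Ideal.mem_span_singleton.1 hmem
  have hg0 : g ≠ 0 := fun h => hmon.ne_zero (zero_dvd_iff.1 (h ▸ hdvd))
  have hdeg : (charpolyOfModule F V).natDegree = g.natDegree := by
    rw [LinearMap.charpoly_natDegree, ← finrank_quotient_span_eq_natDegree]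
    exact (e.restrictScalars F).finrank_eq
  have hass : Associated g (charpolyOfModule F V) :=
    Polynomial.associated_of_dvd_of_natDegree_le hdvd hmon.ne_zero hdeg.le
  rw [Ideal.span_singleton_eq_span_singleton.2 hass] at e hI
  refine ⟨?_, ⟨e⟩⟩
  exact ((Ideal.span_singleton_prime hmon.ne_zero).1 hI.isPrime).irreducible

/-! ### Semisimplifications and characteristic polynomials -/

/-- The characteristic polynomial is the product of those of the composition factors; the partial
products are the characteristic polynomials of the steps of the series. -/
theorem CompositionSeries.charpolyOfModule_eq_prod (s : CompositionSeries (Submodule F[X] V))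
    (h0 : s.head = ⊥) (h1 : s.last = ⊤) :
    charpolyOfModule F V = ∏ i, charpolyOfModule F (s.Factor i) := by
  let f : Fin s.length → F[X] := fun i => charpolyOfModule F (s.Factor i)
  have key : ∀ i : Fin (s.length + 1), charpolyOfModule F (s i) = Fin.partialProd f i := by
    intro i
    induction i using Fin.induction with
    | zero =>
      rw [Fin.partialProd_zero]
      have : Subsingleton (s 0) := by
        change s 0 = ⊥ at h0
        rw [h0]
        infer_instance
      exact charpolyOfModule_of_subsingleton
    | succ i ih =>
      rw [Fin.partialProd_succ, ← ih,
        charpolyOfModule_eq_mul ((s i.castSucc).submoduleOf (s i.succ)),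
        charpolyOfModule_congr (Submodule.submoduleOfEquivOfLe (s.step i).le)]
  have h2 := key (Fin.last _)
  have h3 : charpolyOfModule F V = charpolyOfModule F (s (Fin.last _)) := by
    refine charpolyOfModule_congr (Submodule.topEquiv.symm ≪≫ₗ LinearEquiv.ofEq _ _ ?_)
    exact h1.symm
  rw [h3, h2, Fin.partialProd, Fin.val_last, List.take_of_length_le (by simp), List.prod_ofFn]

/-- The terms of the direct sum can be matched because `F[T]` is factorial: the irreducible
factors of the characteristic polynomial determine the composition factors. -/
theorem CompositionSeries.nonempty_graded_equiv_iff (s : CompositionSeries (Submodule F[X] V))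
    (t : CompositionSeries (Submodule F[X] W)) (hs0 : s.head = ⊥) (hs1 : s.last = ⊤)
    (ht0 : t.head = ⊥) (ht1 : t.last = ⊤) :
    Nonempty (s.Graded ≃ₗ[F[X]] t.Graded) ↔ charpolyOfModule F V = charpolyOfModule F W := by
  classical
  have es : s.Graded ≃ₗ[F[X]] ∀ i, s.Factor i := DirectSum.linearEquivFunOnFintype F[X] _ _
  have et : t.Graded ≃ₗ[F[X]] ∀ i, t.Factor i := DirectSum.linearEquivFunOnFintype F[X] _ _
  rw [s.charpolyOfModule_eq_prod hs0 hs1, t.charpolyOfModule_eq_prod ht0 ht1]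
  constructor
  · rintro ⟨e⟩
    rw [← charpolyOfModule_pi s.Factor, ← charpolyOfModule_pi t.Factor]
    exact charpolyOfModule_congr (es.symm ≪≫ₗ e ≪≫ₗ et)
  · intro h
    let a : Fin s.length → F[X] := fun i => charpolyOfModule F (s.Factor i)
    let b : Fin t.length → F[X] := fun i => charpolyOfModule F (t.Factor i)
    have ha : ∀ i, Irreducible (a i) ∧ Nonempty (s.Factor i ≃ₗ[F[X]] F[X] ⧸ Ideal.span {a i}) :=
      fun i => irreducible_charpolyOfModule_and_equiv
    have hb : ∀ i, Irreducible (b i) ∧ Nonempty (t.Factor i ≃ₗ[F[X]] F[X] ⧸ Ideal.span {b i}) :=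
      fun i => irreducible_charpolyOfModule_and_equiv
    have hab : Finset.univ.val.map a = Finset.univ.val.map b := by
      have hrel := UniqueFactorizationMonoid.factors_unique (f := Finset.univ.val.map a)
        (g := Finset.univ.val.map b) (by simpa using fun i => (ha i).1)
        (by simpa using fun i => (hb i).1) (by rw [← Finset.prod, ← Finset.prod]; exact .of_eq h)
      rw [← Multiset.rel_eq]
      refine hrel.mono ?_
      simp only [Multiset.mem_map, Finset.mem_val, Finset.mem_univ, true_and]
      rintro _ ⟨i, rfl⟩ _ ⟨j, rfl⟩ hij
      exact eq_of_monic_of_associated (LinearMap.charpoly_monic _) (LinearMap.charpoly_monic _) hij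
    -- Equal multisets of characteristic polynomials give a bijection between the indices.
    have hfib : ∀ c, Nonempty ({i // a i = c} ≃ {j // b j = c}) := fun c => by
      have hcard : ∀ {n : ℕ} (f : Fin n → F[X]),
          Fintype.card {i // f i = c} = (Finset.univ.val.map f).count c := fun f => by
        rw [Multiset.count_map, Fintype.card_subtype, Finset.card, Finset.filter_val]
        simp only [eq_comm (a := c)]
      exact Fintype.card_eq.1 (by rw [hcard, hcard, hab])
    let ρ : Fin s.length ≃ Fin t.length := Equiv.ofFiberEquiv fun c => (hfib c).some
    have hρ : ∀ i, a i = b (ρ i) := fun i => (Equiv.ofFiberEquiv_map _ i).symm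
    have eQ : ∀ i, Nonempty (s.Factor i ≃ₗ[F[X]] t.Factor (ρ i)) := fun i => by
      obtain ⟨e1⟩ := (ha i).2
      obtain ⟨e2⟩ := (hb (ρ i)).2
      rw [hρ i] at e1
      exact ⟨e1 ≪≫ₗ e2.symm⟩
    exact ⟨es ≪≫ₗ LinearEquiv.piCongrRight (fun i => (eQ i).some) ≪≫ₗ
      LinearEquiv.piCongrLeft F[X] t.Factor ρ ≪≫ₗ et.symm⟩

theorem nonempty_semisimplification_equiv_iff {V : Type v} [AddCommGroup V] [Module F V]
    [Module.Finite F V] {W : Type w} [AddCommGroup W] [Module F W] [Module.Finite F W]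
    (φ : Module.End F V) (ψ : Module.End F W) :
    Nonempty (Semisimplification F[X] (Module.AEval' φ) ≃ₗ[F[X]]
      Semisimplification F[X] (Module.AEval' ψ)) ↔ φ.charpoly = ψ.charpoly := by
  have hs := (exists_compositionSeries_of_isNoetherian_isArtinian F[X]
    (Module.AEval' φ)).choose_spec
  have ht := (exists_compositionSeries_of_isNoetherian_isArtinian F[X]
    (Module.AEval' ψ)).choose_spec
  rw [CompositionSeries.nonempty_graded_equiv_iff _ _ hs.1 hs.2 ht.1 ht.2,
    charpolyOfModule_aeval', charpolyOfModule_aeval']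

end CharpolyModule

/-! ### The criterion over local domains -/

section Criterion

open Polynomial

/-- Reversal of coefficients turns a congruence of polynomials of equal degree into a
congruence of their reverses, and back. -/
theorem Polynomial.map_eq_map_iff_reverse_sub_mem {R : Type*} [CommRing R] [IsLocalRing R]
    {f g : R[X]} {d : ℕ} (hf : f.natDegree = d) (hg : g.natDegree = d) :
    f.map (IsLocalRing.residue R) = g.map (IsLocalRing.residue R) ↔
      (f.reverse : PowerSeries R) - (g.reverse : PowerSeries R) ∈
        PowerSeries.lowCoeffIdeal (IsLocalRing.maximalIdeal R) d := by
  have h1 : ∀ n, (f.map (IsLocalRing.residue R)).coeff n = (g.map (IsLocalRing.residue R)).coeff n ↔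
      f.coeff n - g.coeff n ∈ IsLocalRing.maximalIdeal R := fun n => by
    rw [coeff_map, coeff_map, ← sub_eq_zero, ← map_sub, IsLocalRing.residue_eq_zero_iff]
  rw [Polynomial.ext_iff, PowerSeries.mem_lowCoeffIdeal]
  simp only [h1, map_sub, Polynomial.coeff_coe, coeff_reverse, hf, hg]
  constructor
  · intro h n _
    exact h _
  · intro h n
    rcases le_or_gt n d with hn | hn
    · have := h (d - n) (Nat.sub_le _ _)
      rwa [revAt_le (Nat.sub_le _ _), Nat.sub_sub_self hn] at this
    · rw [coeff_eq_zero_of_natDegree_lt (hf ▸ hn), coeff_eq_zero_of_natDegree_lt (hg ▸ hn), sub_zero]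
      exact zero_mem _

/-- The trace criterion for endomorphisms: the coefficients of the logarithmic derivatives of the
reverse characteristic polynomials are the traces of the powers. -/
theorem LinearMap.charpoly_map_residue_eq_iff {R : Type*} [CommRing R] [IsLocalRing R]
    [IsDomain R] [CharZero R]
    (hm : ∀ x ∈ IsLocalRing.maximalIdeal R, ∀ k : ℕ, k ≠ 0 →
      x ^ k ∈ Ideal.span {(k : R)} * IsLocalRing.maximalIdeal R)
    {M N : Type*} [AddCommGroup M] [Module R M] [Module.Finite R M] [Module.Free R M]
    [AddCommGroup N] [Module R N] [Module.Finite R N] [Module.Free R N]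
    (f : Module.End R M) (g : Module.End R N) {d : ℕ} (hM : Module.finrank R M = d)
    (hN : Module.finrank R N = d) :
    f.charpoly.map (IsLocalRing.residue R) = g.charpoly.map (IsLocalRing.residue R) ↔
      ∀ n : ℕ, 1 ≤ n → n ≤ d → LinearMap.trace R M (f ^ n) - LinearMap.trace R N (g ^ n) ∈
        Ideal.span {(n : R)} * IsLocalRing.maximalIdeal R := by
  classical
  let b := Module.Free.chooseBasis R M
  let c := Module.Free.chooseBasis R N
  rw [map_eq_map_iff_reverse_sub_mem (f.charpoly_natDegree.trans hM)
    (g.charpoly_natDegree.trans hN), ← LinearMap.charpoly_toMatrix f b,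
    ← LinearMap.charpoly_toMatrix g c, Matrix.reverse_charpoly, Matrix.reverse_charpoly,
    PowerSeries.sub_mem_lowCoeffIdeal_iff hm _ _ (Matrix.isNegLogDeriv_charpolyRev _)
      (Matrix.isNegLogDeriv_charpolyRev _)]
  · refine forall_congr' fun n => forall_congr' fun hn => forall_congr' fun _ => ?_
    obtain ⟨n, rfl⟩ := Nat.exists_eq_add_of_le' hn
    rw [PowerSeries.coeff_succ_X_mul, PowerSeries.coeff_succ_X_mul, PowerSeries.coeff_mk,
      PowerSeries.coeff_mk, LinearMap.toMatrix_pow, LinearMap.toMatrix_pow,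
      ← LinearMap.trace_eq_matrix_trace, ← LinearMap.trace_eq_matrix_trace]
  · rw [Polynomial.constantCoeff_coe, coeff_zero_eq_eval_zero,
      Matrix.eval_charpolyRev]
  · rw [Polynomial.constantCoeff_coe, coeff_zero_eq_eval_zero,
      Matrix.eval_charpolyRev]

theorem nonempty_semisimplification_reduction_equiv_iff {R : Type u} [CommRing R] [IsLocalRing R]
    [IsDomain R] [CharZero R]
    (hm : ∀ x ∈ IsLocalRing.maximalIdeal R, ∀ k : ℕ, k ≠ 0 →
      x ^ k ∈ Ideal.span {(k : R)} * IsLocalRing.maximalIdeal R) {d : ℕ}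
    (M : Type v) [AddCommGroup M] [Module R M] [Module R[X] M] [IsScalarTower R R[X] M]
    [Module.Finite R M] [Module.Free R M]
    (N : Type w) [AddCommGroup N] [Module R N] [Module R[X] N] [IsScalarTower R R[X] N]
    [Module.Finite R N] [Module.Free R N]
    (hM : Module.finrank R M = d) (hN : Module.finrank R N = d) :
    Nonempty (Semisimplification (IsLocalRing.ResidueField R)[X] (ReductionModule R M)
        ≃ₗ[(IsLocalRing.ResidueField R)[X]]
        Semisimplification (IsLocalRing.ResidueField R)[X] (ReductionModule R N)) ↔
      ∀ n : ℕ, 1 ≤ n → n ≤ d →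
        LinearMap.trace R M (opT R M ^ n) - LinearMap.trace R N (opT R N ^ n) ∈
          Ideal.span {(n : R)} * IsLocalRing.maximalIdeal R := by
  rw [nonempty_semisimplification_equiv_iff, LinearMap.charpoly_baseChange,
    LinearMap.charpoly_baseChange]
  exact LinearMap.charpoly_map_residue_eq_iff hm _ _ hM hN

end Criterion

/-! ### `p`-adic integers and rings of integers of `p`-adic fields -/

theorem PadicInt.isUnit_natCast_of_coprime {p : ℕ} [Fact p.Prime] {k : ℕ} (h : p.Coprime k) :
    IsUnit (k : ℤ_[p]) :=
  PadicInt.isUnit_iff.2 (PadicInt.norm_natCast_eq_one_iff.2 h)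

theorem PadicInt.pow_mem_span_natCast_mul {p : ℕ} [hp : Fact p.Prime] {x : ℤ_[p]}
    (hx : x ∈ IsLocalRing.maximalIdeal ℤ_[p]) {k : ℕ} (hk : k ≠ 0) :
    x ^ k ∈ Ideal.span {(k : ℤ_[p])} * IsLocalRing.maximalIdeal ℤ_[p] :=
  Ideal.pow_mem_span_natCast_mul (e := 1) hp.out
    (fun _ h => PadicInt.isUnit_natCast_of_coprime h)
    (by rw [pow_one, PadicInt.maximalIdeal_eq_span_p]) (by have := hp.out.two_le; omega) hx hk

theorem PadicInt.span_natCast_mul_maximalIdeal {p : ℕ} [hp : Fact p.Prime] {n : ℕ} (hn : n ≠ 0) :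
    Ideal.span {(n : ℤ_[p])} * IsLocalRing.maximalIdeal ℤ_[p] =
      Ideal.span {(p : ℤ_[p]) ^ (1 + padicValNat p n)} := by
  obtain ⟨j, k, hk, rfl⟩ := Nat.exists_eq_pow_mul_and_not_dvd hn p hp.out.ne_one
  have hu : IsUnit (k : ℤ_[p]) :=
    PadicInt.isUnit_natCast_of_coprime ((Nat.Prime.coprime_iff_not_dvd hp.out).2 hk)
  have hk0 : k ≠ 0 := by rintro rfl; simp at hk
  rw [padicValNat.mul (pow_ne_zero _ hp.out.ne_zero) hk0, padicValNat.prime_pow,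
    padicValNat.eq_zero_of_not_dvd hk, Nat.cast_mul, Nat.cast_pow,
    Ideal.span_singleton_mul_right_unit hu, PadicInt.maximalIdeal_eq_span_p,
    Ideal.span_singleton_mul_span_singleton, add_zero, add_comm, pow_succ]

namespace PadicDVR

variable {p : ℕ} [hp : Fact p.Prime] {K : Type u} [Field K] [Algebra ℤ_[p] K]

theorem map_maximalIdeal : (IsLocalRing.maximalIdeal ℤ_[p]).map (algebraMap ℤ_[p] (PadicDVR p K)) =
    Ideal.span {(p : PadicDVR p K)} := by
  rw [PadicInt.maximalIdeal_eq_span_p, Ideal.map_span, Set.image_singleton, map_natCast]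

theorem isUnit_natCast_of_coprime {k : ℕ} (h : p.Coprime k) : IsUnit (k : PadicDVR p K) := by
  rw [← map_natCast (algebraMap ℤ_[p] (PadicDVR p K))]
  exact (PadicInt.isUnit_natCast_of_coprime h).map _

variable [Algebra ℚ_[p] K]

theorem charZero : CharZero (PadicDVR p K) := by
  have : CharZero K := charZero_of_injective_algebraMap (algebraMap ℚ_[p] K).injective
  exact (algebraMap (PadicDVR p K) K).charZero

variable [IsScalarTower ℤ_[p] ℚ_[p] K]

theorem isDedekindDomain [FiniteDimensional ℚ_[p] K] : IsDedekindDomain (PadicDVR p K) :=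
  integralClosure.isDedekindDomain ℤ_[p] ℚ_[p] K

/-- In the ring of integers of a `p`-adic field, `(p)` is the power of the maximal ideal given by
the ramification index. -/
theorem maximalIdeal_pow_ramificationIdx [FiniteDimensional ℚ_[p] K] :
    IsLocalRing.maximalIdeal (PadicDVR p K) ^
      (IsLocalRing.maximalIdeal (PadicDVR p K)).ramificationIdx ℤ_[p] =
        Ideal.span {(p : PadicDVR p K)} := by
  have := isDedekindDomain (p := p) (K := K)
  have := charZero (p := p) (K := K)
  set m := IsLocalRing.maximalIdeal (PadicDVR p K)
  have : m.LiesOver (IsLocalRing.maximalIdeal ℤ_[p]) := by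
    have : (m.under ℤ_[p]).IsMaximal := Ideal.isMaximal_comap_of_isIntegral_of_isMaximal m
    exact ⟨(IsLocalRing.eq_maximalIdeal this).symm⟩
  have hp0 : Ideal.span {(p : PadicDVR p K)} ≠ ⊥ := by
    rw [Ne, Ideal.span_singleton_eq_bot, Nat.cast_eq_zero]
    exact hp.out.ne_zero
  have hbot : m ≠ ⊥ := by
    intro h
    have h1 : (p : PadicDVR p K) ∈ m := by
      have := Ideal.map_le_of_le_comap (Ideal.over_def m (IsLocalRing.maximalIdeal ℤ_[p])).le
      rw [map_maximalIdeal] at this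
      exact this (Ideal.mem_span_singleton_self _)
    rw [h, Ideal.mem_bot, Nat.cast_eq_zero] at h1
    exact hp.out.ne_zero h1
  have hmap := map_maximalIdeal (p := p) (K := K)
  have hfield : ¬ IsField (PadicDVR p K) := fun h =>
    hbot (IsLocalRing.isField_iff_maximalIdeal_eq.1 h)
  have hpow : ∀ I : Ideal (PadicDVR p K), I ≠ ⊥ → ∃ n : ℕ, I = m ^ n :=
    ((IsDiscreteValuationRing.TFAE (PadicDVR p K) hfield).out 2 6).1 ‹_›
  obtain ⟨n, hn⟩ := hpow _ hp0
  rw [Ideal.IsDedekindDomain.ramificationIdx_eq_multiplicity (IsLocalRing.maximalIdeal ℤ_[p]) m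
    (hmap ▸ hp0), hmap, hn, multiplicity_pow_self hbot]
  exact Ideal.isUnit_iff.not.2 (IsLocalRing.maximalIdeal.isMaximal _).ne_top
theorem pow_mem_span_natCast_mul [FiniteDimensional ℚ_[p] K]
    (he : (IsLocalRing.maximalIdeal (PadicDVR p K)).ramificationIdx ℤ_[p] ≤ p - 1)
    {x : PadicDVR p K} (hx : x ∈ IsLocalRing.maximalIdeal (PadicDVR p K)) {k : ℕ} (hk : k ≠ 0) :
    x ^ k ∈ Ideal.span {(k : PadicDVR p K)} * IsLocalRing.maximalIdeal (PadicDVR p K) := by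
  have h1 := (maximalIdeal_pow_ramificationIdx (p := p) (K := K)).le
  generalize (IsLocalRing.maximalIdeal (PadicDVR p K)).ramificationIdx ℤ_[p] = e at h1 he
  exact Ideal.pow_mem_span_natCast_mul hp.out (fun _ h => isUnit_natCast_of_coprime h) h1 he hx hk

end PadicDVR

theorem theorem6p1 (p : ℕ) [Fact p.Prime] :
    (∀ (K : Type u) [Field K] [Algebra ℚ_[p] K] [FiniteDimensional ℚ_[p] K]
        [Algebra ℤ_[p] K] [IsScalarTower ℤ_[p] ℚ_[p] K],
      (IsLocalRing.maximalIdeal (PadicDVR p K)).ramificationIdx ℤ_[p] ≤ p - 1 →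
      ∀ (d : ℕ)
        (M : Type v) [AddCommGroup M] [Module (PadicDVR p K) M] [Module (PadicDVR p K)[X] M]
        [IsScalarTower (PadicDVR p K) (PadicDVR p K)[X] M]
        [Module.Finite (PadicDVR p K) M] [Module.Free (PadicDVR p K) M]
        (N : Type w) [AddCommGroup N] [Module (PadicDVR p K) N] [Module (PadicDVR p K)[X] N]
        [IsScalarTower (PadicDVR p K) (PadicDVR p K)[X] N]
        [Module.Finite (PadicDVR p K) N] [Module.Free (PadicDVR p K) N],
        Module.finrank (PadicDVR p K) M = d → Module.finrank (PadicDVR p K) N = d →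
        (Nonempty
            (Semisimplification (IsLocalRing.ResidueField (PadicDVR p K))[X]
                (ReductionModule (PadicDVR p K) M)
              ≃ₗ[(IsLocalRing.ResidueField (PadicDVR p K))[X]]
              Semisimplification (IsLocalRing.ResidueField (PadicDVR p K))[X]
                (ReductionModule (PadicDVR p K) N)) ↔
          ∀ n : ℕ, 1 ≤ n → n ≤ d →
            LinearMap.trace (PadicDVR p K) M (opT (PadicDVR p K) M ^ n) -
                LinearMap.trace (PadicDVR p K) N (opT (PadicDVR p K) N ^ n) ∈
              Ideal.span {(n : PadicDVR p K)} * IsLocalRing.maximalIdeal (PadicDVR p K))) ∧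
    (∀ (d : ℕ)
        (M : Type v) [AddCommGroup M] [Module ℤ_[p] M] [Module ℤ_[p][X] M]
        [IsScalarTower ℤ_[p] ℤ_[p][X] M] [Module.Finite ℤ_[p] M] [Module.Free ℤ_[p] M]
        (N : Type w) [AddCommGroup N] [Module ℤ_[p] N] [Module ℤ_[p][X] N]
        [IsScalarTower ℤ_[p] ℤ_[p][X] N] [Module.Finite ℤ_[p] N] [Module.Free ℤ_[p] N],
        Module.finrank ℤ_[p] M = d → Module.finrank ℤ_[p] N = d →
        (Nonempty
            (Semisimplification (IsLocalRing.ResidueField ℤ_[p])[X] (ReductionModule ℤ_[p] M)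
              ≃ₗ[(IsLocalRing.ResidueField ℤ_[p])[X]]
              Semisimplification (IsLocalRing.ResidueField ℤ_[p])[X] (ReductionModule ℤ_[p] N)) ↔
          ∀ n : ℕ, 1 ≤ n → n ≤ d →
            LinearMap.trace ℤ_[p] M (opT ℤ_[p] M ^ n) - LinearMap.trace ℤ_[p] N (opT ℤ_[p] N ^ n) ∈
              Ideal.span {(p : ℤ_[p]) ^ (1 + padicValNat p n)})) := by
  refine ⟨fun K _ _ _ _ _ he d M _ _ _ _ _ _ N _ _ _ _ _ _ hM hN => ?_,
    fun d M _ _ _ _ _ _ N _ _ _ _ _ _ hM hN => ?_⟩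
  · have := PadicDVR.charZero (p := p) (K := K)
    exact nonempty_semisimplification_reduction_equiv_iff
      (fun x hx k hk => PadicDVR.pow_mem_span_natCast_mul he hx hk) M N hM hN
  · rw [nonempty_semisimplification_reduction_equiv_iff
      (fun x hx k hk => PadicInt.pow_mem_span_natCast_mul hx hk) M N hM hN]
    refine forall_congr' fun n => forall_congr' fun hn => ?_
    rw [PadicInt.span_natCast_mul_maximalIdeal (by omega)]
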